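/- Let $k$ be an algebraically closed field of characteristic $p>0$, let $X$ be a positive-dimensional projective variety over $k$ (an integral closed subscheme of some $\mathbf{P}^n_k$), and let $x\in X$ be a closed point with ideal sheaf $\mathfrak{m}_x\subset\mathcal{O}_X$. For an ideal sheaf $\mathfrak{a}$, let $\mathfrak{a}^{[p^e]}$ be its $e$-th Frobenius power, generated locally by the $p^e$-th powers of the sections of $\mathfrak{a}$. For a line bundle $M$ on $X$ and an integer $\ell\ge 0$, let $s_F^\ell(M;x)$ be the largest integer $e\ge 0$ for which the restriction map $$H^0(X,M)\longrightarrow H^0\bigl(X,M\otimes\mathcal{O}_X/(\mathfrak{m}_x^{\ell+1})^{[p^e]}\bigr)$$ is surjective, and $s_F^\ell(M;x)=-\infty$ if there is no such $e$. The $\ell$-th Frobenius--Seshadri constant of a line bundle $L$ at $x$ is $$\varepsilon_F^\ell(L;x)=\sup_{m\ge 1}\frac{p^{s_F^\ell(L^{m};x)}-1}{m/(\ell+1)},\qquad p^{-\infty}=0 .$$ If $L$ is ample, then for all integers $\ell\ge 0$ and $r>0$, $$\varepsilon_F^\ell(L^{r};x)=r\cdot\varepsilon_F^\ell(L;x).$$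 -/

import Mathlib

open CategoryTheory AlgebraicGeometry TopologicalSpace Opposite

universe u

noncomputable section

namespace FrobSeshadri

/-! ### Sheaves of modules: tensor products, tensor powers, line bundles -/

section Modules

variable {X : Scheme.{u}}

/-- The structure sheaf `𝒪_X` as a sheaf of modules over itself. -/
abbrev structureSheaf (X : Scheme.{u}) : X.Modules := SheafOfModules.unit X.ringCatSheaf

/-- The presheaf tensor product `U ↦ M(U) ⊗ N(U)`, the tensor product being over `𝒪_X(U)`. -/
def presheafTensor (M N : X.Modules) : X.PresheafOfModules :=
  PresheafOfModules.Monoidal.tensorObj (R := X.presheaf) M.val N.val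

/-- The tensor product `M ⊗ N` of sheaves of `𝒪_X`-modules: the sheafification of
`U ↦ M(U) ⊗ N(U)`. -/
def tensor (M N : X.Modules) : X.Modules :=
  (PresheafOfModules.sheafification (𝟙 X.ringCatSheaf.obj)).obj (presheafTensor M N)

/-- The section `s ⊗ t` of `M ⊗ N` over `U` defined by sections `s` of `M` and `t` of `N`. -/
def tmul {M N : X.Modules} {U : X.Opens} (s : Γ(M, U)) (t : Γ(N, U)) : Γ(tensor M N, U) :=
  (toSheafify (Opens.grothendieckTopology X) (presheafTensor M N).presheaf).app (op U)
    (TensorProduct.tmul Γ(X, U) (M := Γ(M, U)) (N := Γ(N, U)) s t)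

/-- The tensor power `L ^ n`, with `L ^ 0 = 𝒪_X`. -/
def tensorPow (L : X.Modules) : ℕ → X.Modules
  | 0 => structureSheaf X
  | n + 1 => tensor (tensorPow L n) L

/-- A line bundle (invertible sheaf): a sheaf of `𝒪_X`-modules that is locally isomorphic
to `𝒪_X`. -/
def IsLineBundle (L : X.Modules) : Prop :=
  ∀ x : X, ∃ U : X.Opens, x ∈ U ∧ Nonempty (L.restrict U.ι ≅ structureSheaf U.toScheme)

/-- For a global section `s` of a line bundle `L`, the open set `X_s` on which `s` does not vanish:
the largest open subset over which multiplication by `s` is an isomorphism `𝒪_X ≅ L`. -/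
def nonvanishing {L : X.Modules} (s : Γ(L, ⊤)) : X.Opens :=
  sSup {U | ∀ V ≤ U, Function.Bijective
    fun f : Γ(X, V) ↦ f • (L.presheaf.map (homOfLE (le_top : V ≤ ⊤)).op s)}

/-- A line bundle `L` on a quasi-compact scheme is ample if the affine open sets of the form `X_s`,
for `s` a global section of some `L ^ n` with `n ≥ 1`, cover `X`. -/
def IsAmple (L : X.Modules) : Prop :=
  CompactSpace X ∧ IsLineBundle L ∧
    ∀ x : X, ∃ n : ℕ, 1 ≤ n ∧ ∃ s : Γ(tensorPow L n, ⊤),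
      x ∈ nonvanishing s ∧ IsAffineOpen (nonvanishing s)

end Modules

/-! ### Projective varieties -/

section Projective

attribute [local instance] MvPolynomial.gradedAlgebra

variable (k : Type u) [Field k]

/-- Projective space `ℙⁿ` over `k`, as `Proj k[x₀, …, xₙ]`. -/
def projectiveSpace (n : ℕ) : Scheme.{u} :=
  Proj (MvPolynomial.homogeneousSubmodule (Fin (n + 1)) k)

/-- The structure morphism `ℙⁿ ⟶ Spec k`. -/
def projectiveSpaceToSpec (n : ℕ) : projectiveSpace k n ⟶ Spec (.of k) :=
  Proj.toSpecZero (MvPolynomial.homogeneousSubmodule (Fin (n + 1)) k) ≫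
    Spec.map (CommRingCat.ofHom
      (algebraMap k (MvPolynomial.homogeneousSubmodule (Fin (n + 1)) k 0)))

variable {k}

/-- A `k`-scheme `π : X ⟶ Spec k` is a projective variety if it is integral (that is, reduced and
irreducible) and admits a closed immersion over `k` into some projective space `ℙⁿ` over `k`. -/
structure IsProjectiveVariety {X : Scheme.{u}} (π : X ⟶ Spec (.of k)) : Prop where
  isIntegral : IsIntegral X
  exists_closedImmersion : ∃ (n : ℕ) (i : X ⟶ projectiveSpace k n),
    IsClosedImmersion i ∧ i ≫ projectiveSpaceToSpec k n = π

end Projective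

/-! ### Frobenius powers of ideal sheaves -/

section Ideals

variable {X : Scheme.{u}}

/-- The ideal generated by the `q`-th powers of the elements of `I`. -/
def idealFrobPow {R : Type*} [CommRing R] (q : ℕ) (I : Ideal R) : Ideal R :=
  Ideal.span ((fun f ↦ f ^ q) '' (I : Set R))

theorem idealFrobPow_map_of_isLocalization {R S : Type*} [CommRing R] [CommRing S] [Algebra R S]
    (M : Submonoid R) [IsLocalization M S] (q : ℕ) (I : Ideal R) :
    (idealFrobPow q I).map (algebraMap R S) = idealFrobPow q (I.map (algebraMap R S)) := by
  apply le_antisymm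
  · rw [idealFrobPow, Ideal.map_span, Ideal.span_le]
    rintro _ ⟨_, ⟨f, hf, rfl⟩, rfl⟩
    rw [map_pow]
    exact Ideal.subset_span ⟨_, Ideal.mem_map_of_mem _ hf, rfl⟩
  · rw [idealFrobPow, Ideal.span_le]
    rintro _ ⟨g, hg, rfl⟩
    obtain ⟨⟨f, s⟩, h⟩ := (IsLocalization.mem_map_algebraMap_iff M S).mp hg
    have h' : g ^ q * algebraMap R S s ^ q = algebraMap R S (f.1 ^ q) := by
      rw [← mul_pow, h, map_pow]
    have hu : IsUnit (algebraMap R S s ^ q) := (IsLocalization.map_units S s).pow q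
    refine (Ideal.mul_unit_mem_iff_mem _ hu).mp ?_
    rw [h']
    exact Ideal.mem_map_of_mem _ (Ideal.subset_span ⟨_, f.2, rfl⟩)

/-- The Frobenius power `𝔞^[q]` of an ideal sheaf: over an affine open set, it is generated by the
`q`-th powers of the sections of `𝔞`. For `q = p ^ e` on a scheme of characteristic `p`, this is the
inverse image of `𝔞` under the `e`-th iterate of the Frobenius morphism. -/
def frobPow (q : ℕ) (I : X.IdealSheafData) : X.IdealSheafData where
  ideal U := idealFrobPow q (I.ideal U)
  map_ideal_basicOpen U f := by
    let : Algebra Γ(X, U) Γ(X, X.affineBasicOpen f) :=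
      (X.presheaf.map (homOfLE (X.basicOpen_le f)).op).hom.toAlgebra
    have : IsLocalization.Away f Γ(X, X.basicOpen f) :=
      U.2.isLocalization_of_eq_basicOpen _ _ rfl
    exact (idealFrobPow_map_of_isLocalization (S := Γ(X, X.basicOpen f)) (.powers f) q (I.ideal U)).trans
      congr(idealFrobPow q $(I.map_ideal_basicOpen U f))

/-- The ideal sheaf `𝔪_x` of a closed point `x`. -/
def idealOfPoint (x : X) (hx : IsClosed {x}) : X.IdealSheafData :=
  Scheme.IdealSheafData.vanishingIdeal ⟨{x}, hx⟩

/-- The quotient `𝒪_X / 𝔞` as an `𝒪_X`-module: the pushforward of the structure sheaf of the closed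
subscheme defined by `𝔞`. -/
def quotientSheaf (I : X.IdealSheafData) : X.Modules :=
  (Scheme.Modules.pushforward I.subschemeι).obj (structureSheaf I.subscheme)

/-- The image of `1` in the global sections of `𝒪_X / 𝔞`. -/
def quotientOne (I : X.IdealSheafData) : Γ(quotientSheaf I, ⊤) :=
  (1 : Γ(I.subscheme, I.subschemeι ⁻¹ᵁ ⊤))

/-- The restriction map `H⁰(X, M) ⟶ H⁰(X, M ⊗ 𝒪_X / 𝔞)`, sending `s` to `s ⊗ 1`. -/
def restriction (M : X.Modules) (I : X.IdealSheafData) (s : Γ(M, ⊤)) :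
    Γ(tensor M (quotientSheaf I), ⊤) :=
  tmul s (quotientOne I)

end Ideals

/-! ### Frobenius–Seshadri constants -/

section Seshadri

variable {X : Scheme.{u}}

/-- `M` separates `p ^ e`-Frobenius `ℓ`-jets at the closed point `x`: the restriction map
`H⁰(X, M) ⟶ H⁰(X, M ⊗ 𝒪_X / (𝔪_x ^ (ℓ + 1))^[p ^ e])` is surjective. -/
def SeparatesFrobJets (p ℓ e : ℕ) (M : X.Modules) (x : X) (hx : IsClosed {x}) : Prop :=
  Function.Surjective (restriction M (frobPow (p ^ e) (idealOfPoint x hx ^ (ℓ + 1))))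

open Classical in
/-- The largest `e ≥ 0` such that `M` separates `p ^ e`-Frobenius `ℓ`-jets at `x`. It is `⊥ = -∞` if
there is no such `e`, and `⊤ = +∞` if there are arbitrarily large such `e`. -/
def sF (p ℓ : ℕ) (M : X.Modules) (x : X) (hx : IsClosed {x}) : WithBot ℕ∞ :=
  if ∃ e : ℕ, SeparatesFrobJets p ℓ e M x hx then
    ((⨆ e : {e : ℕ // SeparatesFrobJets p ℓ e M x hx}, ((e : ℕ) : ℕ∞) : ℕ∞) : WithBot ℕ∞)
  else ⊥

/-- The power `p ^ s` for `s ∈ {-∞} ∪ ℕ ∪ {+∞}`, with `p ^ (-∞) = 0` and `p ^ (+∞) = +∞`. -/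
def extPow (p : ℕ) : WithBot ℕ∞ → EReal
  | none => 0
  | some none => ⊤
  | some (some n) => ((p ^ n : ℕ) : EReal)

/-- The `ℓ`-th Frobenius–Seshadri constant of `L` at `x`: the supremum over all `m ≥ 1` of
`(p ^ s - 1) / (m / (ℓ + 1))`, where `s` is the largest `e` such that `L ^ m` separates
`p ^ e`-Frobenius `ℓ`-jets at `x`. -/
def frobSeshadri (p ℓ : ℕ) (L : X.Modules) (x : X) (hx : IsClosed {x}) : EReal :=
  ⨆ (m : ℕ) (_ : 1 ≤ m),
    (extPow p (sF p ℓ (tensorPow L m) x hx) - 1) / (((m : ℝ) / ((ℓ : ℝ) + 1) : ℝ) : EReal)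

end Seshadri

end FrobSeshadri

end

/-! Write `S m e` for "`L ^ m` separates `p ^ e`-Frobenius `ℓ`-jets at `x`". The theorem follows
formally from two properties of `S`: it is inherited by smaller `e`, and `S m e`, `S n e'` imply `S
(m * p ^ e' + n) (e + e')`. Put `q = p ^ e`. Iterating the second property from `S m e` gives `S (m
* (σ n + j)) (n * e)` for `σ n = 1 + q + ... + q ^ (n - 1)` and any `j ≥ 1` (`rel_geomSum`). Since
`q ^ n - 1 = (q - 1) * σ n`, the corresponding ratios tend to that of `(m, e)` as `n → ∞` with `j`
bounded. Some `j ≤ r` makes `σ n + j` divisible by `r`, so multiples of `r` already compute the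
supremum (`seshadriSup_mul`). For the properties of `S`, fix an affine neighbourhood `U` of `x` with
a generator `t` of `L`. Sections of `L ^ n` become the functions `f` on `U` for which `f • t ^ n`
extends (`extendable`), and `S n e` says that these functions surject onto `Γ(X, U) / I^[p ^ e]`,
with `I` the `(ℓ + 1)`-st power of the ideal of `x` (`separatesFrobJets_iff`). The second property
is then commutative algebra (`sup_idealFrobPow_eq_top`). -/

noncomputable section

namespace FrobSeshadri

/-! ### Generators of sheaves of modules and sections of tensor products. -/

section Sections

variable {X : Scheme.{u}}

/-- Restriction of sections of a sheaf of modules. -/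
def res (M : X.Modules) {U V : X.Opens} (h : V ≤ U) : Γ(M, U) →+ Γ(M, V) :=
  (M.presheaf.map (homOfLE h).op).hom

/-- Restriction of functions. -/
def resO {U V : X.Opens} (h : V ≤ U) : Γ(X, U) →+* Γ(X, V) :=
  (X.presheaf.map (homOfLE h).op).hom

@[simp]
theorem res_res (M : X.Modules) {U V W : X.Opens} (h : V ≤ U) (h' : W ≤ V) (s : Γ(M, U)) :
    res M h' (res M h s) = res M (h'.trans h) s := by
  have := congr($(M.presheaf.map_comp (homOfLE h).op (homOfLE h').op) s)
  exact this.symm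

@[simp]
theorem res_refl (M : X.Modules) {U : X.Opens} (s : Γ(M, U)) : res M le_rfl s = s :=
  congr($(M.presheaf.map_id (op U)) s)

@[simp]
theorem res_smul (M : X.Modules) {U V : X.Opens} (h : V ≤ U) (f : Γ(X, U)) (s : Γ(M, U)) :
    res M h (f • s) = resO h f • res M h s :=
  M.map_smul (homOfLE h) f s

theorem section_ext (M : X.Modules) {ι : Type u} {V : X.Opens} (W : ι → X.Opens)
    (hW : ∀ i, W i ≤ V) (hc : V ≤ iSup W) {s t : Γ(M, V)}
    (h : ∀ i, res M (hW i) s = res M (hW i) t) : s = t :=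
  TopCat.Sheaf.eq_of_locally_eq' ⟨M.presheaf, M.isSheaf⟩ W V (fun i ↦ homOfLE (hW i)) hc s t h

theorem exists_glue (M : X.Modules) {ι : Type u} {V : X.Opens} (W : ι → X.Opens)
    (hW : ∀ i, W i ≤ V) (hc : V ≤ iSup W) (sf : ∀ i, Γ(M, W i))
    (h : ∀ i j, res M (inf_le_left : W i ⊓ W j ≤ W i) (sf i) =
      res M (inf_le_right : W i ⊓ W j ≤ W j) (sf j)) :
    ∃ s : Γ(M, V), ∀ i, res M (hW i) s = sf i :=
  (TopCat.Sheaf.existsUnique_gluing' ⟨M.presheaf, M.isSheaf⟩ W V (fun i ↦ homOfLE (hW i)) hc sf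
    h).exists

/-- A section `t` of `M` over `U` is a generator if multiplication by `t` is an isomorphism
`𝒪_X ≅ M` over `U`. -/
def IsGenerator (M : X.Modules) {U : X.Opens} (t : Γ(M, U)) : Prop :=
  ∀ ⦃V : X.Opens⦄ (h : V ≤ U), Function.Bijective fun f : Γ(X, V) ↦ f • res M h t

theorem IsGenerator.res {M : X.Modules} {U V : X.Opens} {t : Γ(M, U)} (ht : IsGenerator M t)
    (h : V ≤ U) : IsGenerator M (res M h t) := by
  intro W hW
  simpa using ht (hW.trans h)

theorem isGenerator_one (U : X.Opens) :
    IsGenerator (structureSheaf X) (U := U) (1 : Γ(X, U)) := by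
  intro V h
  have h1 : FrobSeshadri.res (structureSheaf X) h (1 : Γ(X, U)) = (1 : Γ(X, V)) :=
    map_one (resO h)
  rw [h1]
  have : (fun f : Γ(X, V) ↦ f • (show Γ(structureSheaf X, V) from (1 : Γ(X, V)))) =
      fun f ↦ f := by
    funext f
    exact mul_one f
  rw [this]
  exact Function.bijective_id

/-! ### Sections of tensor products -/

theorem tmul_res (M N : X.Modules) {U V : X.Opens} (h : V ≤ U) (s : Γ(M, U)) (t : Γ(N, U)) :
    res (tensor M N) h (tmul s t) = tmul (res M h s) (res N h t) := by
  have := congr($((toSheafify (Opens.grothendieckTopology X)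
    (presheafTensor M N).presheaf).naturality (homOfLE h).op)
    (TensorProduct.tmul Γ(X, U) (M := Γ(M, U)) (N := Γ(N, U)) s t))
  exact this.symm

theorem tmul_add (M N : X.Modules) {U : X.Opens} (s : Γ(M, U)) (t t' : Γ(N, U)) :
    tmul s (t + t') = tmul s t + tmul s t' := by
  unfold tmul
  rw [TensorProduct.tmul_add]
  exact map_add ((toSheafify (Opens.grothendieckTopology X)
    (presheafTensor M N).presheaf).app (op U)).hom _ _

/-- The unit of the sheafification, on sections. -/
def tensorUnitHom (M N : X.Modules) (U : X.Opens) :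
    TensorProduct Γ(X, U) Γ(M, U) Γ(N, U) →+ Γ(tensor M N, U) :=
  ((toSheafify (Opens.grothendieckTopology X) (presheafTensor M N).presheaf).app (op U)).hom

theorem tensorUnitHom_smul (M N : X.Modules) (U : X.Opens) (f : Γ(X, U))
    (z : TensorProduct Γ(X, U) Γ(M, U) Γ(N, U)) :
    tensorUnitHom M N U (f • z) = f • tensorUnitHom M N U z :=
  ((PresheafOfModules.toSheafify (𝟙 X.ringCatSheaf.obj) (toSheafify
    (Opens.grothendieckTopology X) (presheafTensor M N).presheaf)).app (op U)).hom.map_smul f z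

theorem tmul_smul (M N : X.Modules) {U : X.Opens} (f : Γ(X, U)) (s : Γ(M, U)) (t : Γ(N, U)) :
    tmul s (f • t) = f • tmul s t := by
  refine Eq.trans ?_ (tensorUnitHom_smul M N U f _)
  rw [← TensorProduct.tmul_smul]
  rfl

theorem smul_tmul (M N : X.Modules) {U : X.Opens} (f : Γ(X, U)) (s : Γ(M, U)) (t : Γ(N, U)) :
    tmul (f • s) t = f • tmul s t := by
  rw [← tmul_smul]
  unfold tmul
  rw [TensorProduct.smul_tmul]

theorem exists_tensorUnitHom_eq (M N : X.Modules) (U : X.Opens) (y : Γ(tensor M N, U)) (x : X)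
    (hx : x ∈ U) : ∃ (V : X.Opens) (h : V ≤ U), x ∈ V ∧ ∃ z, tensorUnitHom M N V z = res _ h y := by
  obtain ⟨V, f, ⟨z, hz⟩, hV⟩ := Presheaf.imageSieve_mem (Opens.grothendieckTopology X)
    (toSheafify (Opens.grothendieckTopology X) (presheafTensor M N).presheaf) y x hx
  exact ⟨V, leOfHom f, hV, z, hz⟩

theorem exists_map_eq_zero (M N : X.Modules) (U : X.Opens)
    (s : Γ(M, U)) (t : Γ(N, U)) (h0 : tmul s t = 0) (x : X) (hx : x ∈ U) :
    ∃ (V : X.Opens) (h : V ≤ U), x ∈ V ∧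
      TensorProduct.tmul Γ(X, V) (res M h s) (res N h t) = 0 := by
  obtain ⟨V, f, hf, hV⟩ := Presheaf.equalizerSieve_mem (Opens.grothendieckTopology X)
    (toSheafify (Opens.grothendieckTopology X) (presheafTensor M N).presheaf)
    (X := op U) (TensorProduct.tmul Γ(X, U) (M := Γ(M, U)) (N := Γ(N, U)) s t) 0
    (h0.trans (map_zero (tensorUnitHom M N U)).symm) x hx
  refine ⟨V, leOfHom f, hV, ?_⟩
  have h2 := hf
  have h3 : (presheafTensor M N).presheaf.map f.op 0 = 0 :=
    map_zero ((presheafTensor M N).presheaf.map f.op).hom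
  exact Eq.trans (show _ = (presheafTensor M N).presheaf.map f.op
    (TensorProduct.tmul Γ(X, U) (M := Γ(M, U)) (N := Γ(N, U)) s t) from rfl) (hf.trans h3)

theorem _root_.TensorProduct.mk_bijective_of_smul_bijective {R M N : Type*} [CommRing R]
    [AddCommGroup M] [Module R M] [AddCommGroup N] [Module R N] {m : M}
    (hm : Function.Bijective fun f : R ↦ f • m) : Function.Bijective (TensorProduct.mk R M N m) := by
  let e : R ≃ₗ[R] M := LinearEquiv.ofBijective (LinearMap.toSpanSingleton R M m) hm
  have : ⇑(TensorProduct.mk R M N m) =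
      ⇑((TensorProduct.lid R N).symm.trans (TensorProduct.congr e (.refl R N))) := by
    ext n
    have h1 : e 1 = m := one_smul R m
    simp [h1]
  rw [this]
  exact LinearEquiv.bijective _

/-- A section that dies in the sheafification dies locally in the presheaf tensor product, where
tensoring with a generator is an isomorphism. -/
theorem tmul_injective (M N : X.Modules) {U : X.Opens} {s : Γ(M, U)} (hs : IsGenerator M s) :
    Function.Injective fun t : Γ(N, U) ↦ tmul s t := by
  let φ : Γ(N, U) →+ Γ(tensor M N, U) := AddMonoidHom.mk' (fun t ↦ tmul s t) (tmul_add M N s)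
  refine (injective_iff_map_eq_zero φ).mpr fun t ht ↦ ?_
  choose V hV hx h using fun x : U ↦ exists_map_eq_zero M N U s t ht x x.2
  refine section_ext N V hV (fun y hy ↦ Opens.mem_iSup.mpr ⟨⟨y, hy⟩, hx _⟩) fun x ↦ ?_
  rw [map_zero]
  refine (TensorProduct.mk_bijective_of_smul_bijective (N := Γ(N, V x)) (hs (hV x))).1 ?_
  rw [map_zero]
  exact h x

/-- Preimages exist locally, and injectivity on overlaps makes them glue. -/
theorem tmul_bijective (M N : X.Modules) {U : X.Opens} {s : Γ(M, U)} (hs : IsGenerator M s) :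
    Function.Bijective fun t : Γ(N, U) ↦ tmul s t := by
  refine ⟨tmul_injective M N hs, fun y ↦ ?_⟩
  choose V hV hx z hz using fun x : U ↦ exists_tensorUnitHom_eq M N U y x x.2
  choose n hn using fun x : U ↦
    (TensorProduct.mk_bijective_of_smul_bijective (N := Γ(N, V x)) (hs (hV x))).2 (z x)
  have hn' (x : U) : tmul (res M (hV x) s) (n x) = res _ (hV x) y := by
    rw [← hz, ← hn]
    rfl
  have hc : U ≤ iSup V := fun y hy ↦ Opens.mem_iSup.mpr ⟨⟨y, hy⟩, hx _⟩
  obtain ⟨t, ht⟩ := exists_glue N V hV hc n fun i j ↦ by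
    refine tmul_injective M N (hs.res (inf_le_left.trans (hV i))) ?_
    have h1 := congr(res _ (inf_le_left : V i ⊓ V j ≤ V i) $(hn' i))
    have h2 := congr(res _ (inf_le_right : V i ⊓ V j ≤ V j) $(hn' j))
    rw [tmul_res, res_res, res_res] at h1 h2
    exact h1.trans h2.symm
  refine ⟨t, section_ext _ V hV hc fun i ↦ ?_⟩
  rw [tmul_res, ht, hn']

theorem IsGenerator.tmul {M N : X.Modules} {U : X.Opens} {s : Γ(M, U)} {t : Γ(N, U)}
    (hs : IsGenerator M s) (ht : IsGenerator N t) : IsGenerator (tensor M N) (tmul s t) := by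
  intro V h
  have := (tmul_bijective M N (hs.res h)).comp (ht h)
  convert! this using 2 with f
  simp only [Function.comp, tmul_smul, tmul_res]

theorem tensor_subsingleton (M N : X.Modules) {U : X.Opens}
    (h : ∀ x ∈ U, ∃ V : X.Opens, x ∈ V ∧ ∀ W ≤ V, Subsingleton Γ(N, W)) :
    Subsingleton Γ(tensor M N, U) := by
  suffices ∀ y : Γ(tensor M N, U), y = 0 from ⟨fun a b ↦ (this a).trans (this b).symm⟩
  intro y
  choose V hV hx z hz using fun x : U ↦ exists_tensorUnitHom_eq M N U y x x.2
  choose V' hx' hV' using fun x : U ↦ h x x.2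
  refine section_ext _ (fun x ↦ V x ⊓ V' x) (fun x ↦ inf_le_left.trans (hV x))
    (fun y hy ↦ Opens.mem_iSup.mpr ⟨⟨y, hy⟩, hx _, hx' _⟩) fun x ↦ ?_
  rw [← res_res _ (hV x) inf_le_left, ← hz, map_zero]
  induction z x using TensorProduct.induction_on with
  | zero => rw [map_zero, map_zero]
  | add a b ha hb => rw [map_add, map_add, ha, hb, add_zero]
  | tmul a b =>
    refine (tmul_res M N inf_le_left a b).trans ?_
    have := hV' x (V x ⊓ V' x) inf_le_right
    rw [Subsingleton.elim (res N (inf_le_left : V x ⊓ V' x ≤ V x) b) 0]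
    exact map_zero (AddMonoidHom.mk' (fun t ↦ FrobSeshadri.tmul _ t) (tmul_add M N _))

/-- A line bundle has a generator near every point. -/
theorem IsLineBundle.exists_isGenerator {L : X.Modules} (hL : IsLineBundle L) (x : X) :
    ∃ (U : X.Opens) (t : Γ(L, U)), x ∈ U ∧ IsGenerator L t := by
  obtain ⟨U, hx, ⟨e⟩⟩ := hL x
  have hU : U.ι ''ᵁ ⊤ = U := by simp
  let t : Γ(L, U.ι ''ᵁ ⊤) := (e.inv.app ⊤).hom (1 : Γ(U.toScheme, ⊤))
  refine ⟨U.ι ''ᵁ ⊤, t, by rw [hU]; exact hx, fun V hV ↦ ?_⟩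
  -- Over opens of this form, multiplication by `t` is the inverse trivialization composed with the
  -- identification of functions on `W` and on its image.
  obtain ⟨W, rfl⟩ : ∃ W, V = U.ι ''ᵁ W := ⟨U.ι ⁻¹ᵁ V, by
    rw [Scheme.Hom.image_preimage_eq_opensRange_inf, Scheme.Opens.opensRange_ι, inf_eq_right.mpr]
    exact hV.trans_eq hU⟩
  have ht : res L hV t = (e.inv.app W).hom (1 : Γ(U.toScheme, W)) := by
    have h1 := congr($(e.inv.mapPresheaf.naturality (homOfLE (le_top : W ≤ ⊤)).op)
      (1 : Γ(U.toScheme, ⊤)))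
    have h2 : res (structureSheaf U.toScheme) (le_top : W ≤ ⊤) (1 : Γ(U.toScheme, ⊤)) =
      (1 : Γ(U.toScheme, W)) := map_one (resO le_top)
    exact h1.symm.trans congr((e.inv.app W).hom $h2)
  rw [ht]
  have h3 : Function.Bijective (e.inv.app W).hom :=
    ConcreteCategory.bijective_of_isIso (e.inv.app W)
  have h4 : Function.Bijective (U.ι.appIso W).hom :=
    ConcreteCategory.bijective_of_isIso (U.ι.appIso W).hom
  suffices h : (fun f : Γ(X, U.ι ''ᵁ W) ↦ f •
      (show Γ(L, U.ι ''ᵁ W) from (e.inv.app W).hom (1 : Γ(U.toScheme, W)))) =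
      (e.inv.app W).hom ∘ (U.ι.appIso W).hom from by
    rw [h]
    exact h3.comp h4
  funext f
  have h5 := e.inv.app_smul ((U.ι.appIso W).hom f) (show Γ(structureSheaf _, W) from
    (1 : Γ(U.toScheme, W)))
  have h6 : (U.ι.appIso W).hom f • (show Γ(structureSheaf U.toScheme, W) from
    (1 : Γ(U.toScheme, W))) = (U.ι.appIso W).hom f := mul_one (M := Γ(U.toScheme, W)) _
  rw [h6] at h5
  refine Eq.trans ?_ h5.symm
  have h7 : (U.ι.appIso W).inv ((U.ι.appIso W).hom f) = f :=
    congr($((U.ι.appIso W).hom_inv_id) f)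
  exact congr($(h7.symm) • (show Γ(L, U.ι ''ᵁ W) from
    (e.inv.app W).hom (1 : Γ(U.toScheme, W))))

end Sections

/-! ### Sections of powers of a line bundle as functions on a trivializing open set. -/

section Powers

variable {X : Scheme.{u}}

/-- The power `t ^ n` of a section `t` of `L`, as a section of `L ^ n`. -/
def powSection {L : X.Modules} {U : X.Opens} (t : Γ(L, U)) : (n : ℕ) → Γ(tensorPow L n, U)
  | 0 => (1 : Γ(X, U))
  | n + 1 => tmul (powSection t n) t

theorem IsGenerator.powSection {L : X.Modules} {U : X.Opens} {t : Γ(L, U)} (ht : IsGenerator L t) :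
    ∀ n, IsGenerator (tensorPow L n) (powSection t n)
  | 0 => isGenerator_one U
  | n + 1 => (ht.powSection n).tmul ht

theorem res_powSection {L : X.Modules} {U V : X.Opens} (h : V ≤ U) (t : Γ(L, U)) :
    ∀ n, res (tensorPow L n) h (powSection t n) = powSection (res L h t) n
  | 0 => map_one (resO h)
  | n + 1 => (tmul_res _ _ h _ _).trans congr(tmul $(res_powSection h t n) _)

theorem powSection_smul {L : X.Modules} {U : X.Opens} (g : Γ(X, U)) (t : Γ(L, U)) :
    ∀ n, powSection (g • t) n = g ^ n • powSection t n
  | 0 => by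
    rw [pow_zero, one_smul]
    rfl
  | n + 1 => by
    change tmul (powSection (g • t) n) (g • t) = g ^ (n + 1) • tmul (powSection t n) t
    rw [powSection_smul g t n, tmul_smul, smul_tmul, smul_smul, pow_succ']

theorem IsGenerator.res_injective [IsIntegral X] {M : X.Modules} {U W : X.Opens} {w : Γ(M, W)}
    (hw : IsGenerator M w) (hU : (U : Set X).Nonempty) (h : U ⊓ W ≤ W) :
    Function.Injective (FrobSeshadri.res M h) := by
  refine (injective_iff_map_eq_zero _).mpr fun a ha ↦ ?_
  obtain ⟨α, rfl⟩ := (hw le_rfl).2 a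
  suffices α = 0 by simp [this]
  by_cases hW : (W : Set X).Nonempty
  · have : Nonempty ↑(U ⊓ W) :=
      (nonempty_preirreducible_inter U.2 W.2 hU hW).to_subtype
    have hinj : Function.Injective (resO h) := map_injective_of_isIntegral X (homOfLE h)
    refine (injective_iff_map_eq_zero _).mp hinj α ?_
    refine (hw h).1 ?_
    simpa using ha
  · have : W = ⊥ := by
      ext1
      exact Set.not_nonempty_iff_eq_empty.mp hW
    subst this
    exact Subsingleton.elim _ _

/-- Functions `f` on `U` for which the section `f • t` extends to a global section, in terms of a
trivializing cover. -/
theorem IsGenerator.exists_extension_iff [IsIntegral X] {M : X.Modules} {U : X.Opens} (hU : (U : Set X).Nonempty)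
    (t : Γ(M, U)) {W : X → X.Opens} (hW : ∀ y, y ∈ W y) {w : ∀ y, Γ(M, W y)}
    (hw : ∀ y, IsGenerator M (w y)) {g : ∀ y, Γ(X, U ⊓ W y)}
    (hg : ∀ y, FrobSeshadri.res M inf_le_left t = g y • FrobSeshadri.res M inf_le_right (w y))
    (f : Γ(X, U)) :
    (∃ s : Γ(M, ⊤), FrobSeshadri.res M le_top s = f • t) ↔
      ∀ y, ∃ h : Γ(X, W y), resO inf_le_right h = resO (inf_le_left : U ⊓ W y ≤ U) f * g y := by
  constructor
  · rintro ⟨s, hs⟩ y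
    obtain ⟨h, hh⟩ := (hw y le_rfl).2 (FrobSeshadri.res M le_top s)
    refine ⟨h, (hw y inf_le_right).1 ?_⟩
    have h1 := congr(FrobSeshadri.res M (inf_le_left : U ⊓ W y ≤ U) $hs)
    have h2 := congr(FrobSeshadri.res M (inf_le_right : U ⊓ W y ≤ W y) $hh)
    simp only [res_res, res_smul, hg, smul_smul] at h1 h2 ⊢
    exact h2.trans h1
  · intro H
    choose h hh using H
    have key (y : X) (V : X.Opens) (hV : V ≤ U ⊓ W y) :
        FrobSeshadri.res M (hV.trans inf_le_right) (h y • w y) =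
          FrobSeshadri.res M (hV.trans inf_le_left) (f • t) := by
      rw [← res_res M inf_le_right hV, ← res_res M inf_le_left hV, res_smul, hh,
        res_smul M inf_le_left f t, hg, smul_smul]
    -- On overlaps the local sections agree after restriction to `U`, which suffices because `X` is
    -- integral and `U` is nonempty.
    obtain ⟨s, hs⟩ := exists_glue M W (fun y ↦ le_top)
      (fun y _ ↦ Opens.mem_iSup.mpr ⟨y, hW y⟩) (fun y ↦ h y • w y) fun y z ↦ by
        refine ((hw y).res inf_le_left).res_injective hU inf_le_right ?_
        rw [res_res, res_res]
        exact (key y (U ⊓ (W y ⊓ W z)) (inf_le_inf_left U inf_le_left)).trans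
          (key z (U ⊓ (W y ⊓ W z)) (inf_le_inf_left U inf_le_right)).symm
    refine ⟨s, section_ext M (fun y ↦ U ⊓ W y) (fun y ↦ inf_le_left)
      (fun y hy ↦ Opens.mem_iSup.mpr ⟨y, hy, hW y⟩) fun y ↦ ?_⟩
    rw [← key y _ le_rfl, ← hs, res_res, res_res]

/-- The functions `f` on `U` such that `f • t ^ n` extends to a global section of `L ^ n`. -/
def extendable {L : X.Modules} {U : X.Opens} (t : Γ(L, U)) (n : ℕ) : AddSubgroup Γ(X, U) where
  carrier := {f | ∃ s : Γ(tensorPow L n, ⊤), res _ le_top s = f • powSection t n}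
  add_mem' := by
    rintro a b ⟨s, hs⟩ ⟨s', hs'⟩
    exact ⟨s + s', by rw [map_add, hs, hs', add_smul]⟩
  zero_mem' := ⟨0, by simp⟩
  neg_mem' := by
    rintro a ⟨s, hs⟩
    exact ⟨-s, by rw [map_neg, hs, neg_smul]⟩

/-- The bundle `L ^ n` enters the criterion only through `g y ^ n`. Products of sections, and the
comparison of `(L ^ r) ^ m` with `L ^ (r * m)`, thus reduce to identities between functions, with no
isomorphism of tensor powers to construct. -/
theorem mem_extendable_iff [IsIntegral X] {L : X.Modules} {U : X.Opens} (hU : (U : Set X).Nonempty)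
    (t : Γ(L, U)) {W : X → X.Opens} (hW : ∀ y, y ∈ W y) {w : ∀ y, Γ(L, W y)}
    (hw : ∀ y, IsGenerator L (w y)) {g : ∀ y, Γ(X, U ⊓ W y)}
    (hg : ∀ y, res L inf_le_left t = g y • res L inf_le_right (w y)) (n : ℕ) (f : Γ(X, U)) :
    f ∈ extendable t n ↔ ∀ y, ∃ h : Γ(X, W y),
      resO inf_le_right h = resO (inf_le_left : U ⊓ W y ≤ U) f * g y ^ n :=
  IsGenerator.exists_extension_iff hU (powSection t n) hW (fun y ↦ (hw y).powSection n)
    (fun y ↦ by rw [res_powSection, res_powSection, hg, powSection_smul]) f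

theorem exists_cover {L : X.Modules} (hL : IsLineBundle L) {U : X.Opens} (t : Γ(L, U)) :
    ∃ (W : X → X.Opens) (w : ∀ y, Γ(L, W y)) (g : ∀ y, Γ(X, U ⊓ W y)), (∀ y, y ∈ W y) ∧
      (∀ y, IsGenerator L (w y)) ∧
      ∀ y, res L inf_le_left t = g y • res L inf_le_right (w y) := by
  choose W w hW hw using hL.exists_isGenerator
  choose g hg using fun y ↦ (hw y (inf_le_right : U ⊓ W y ≤ W y)).2 (res L inf_le_left t)
  exact ⟨W, w, g, hW, hw, fun y ↦ (hg y).symm⟩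

theorem mul_mem_extendable [IsIntegral X] {L : X.Modules} (hL : IsLineBundle L) {U : X.Opens}
    (hU : (U : Set X).Nonempty) (t : Γ(L, U)) {m n : ℕ} {a b : Γ(X, U)}
    (ha : a ∈ extendable t m) (hb : b ∈ extendable t n) : a * b ∈ extendable t (m + n) := by
  obtain ⟨W, w, g, hW, hw, hg⟩ := exists_cover hL t
  rw [mem_extendable_iff hU t hW hw hg] at *
  intro y
  obtain ⟨h, hh⟩ := ha y
  obtain ⟨h', hh'⟩ := hb y
  exact ⟨h * h', by rw [map_mul, hh, hh', map_mul]; ring⟩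

theorem one_mem_extendable_zero {L : X.Modules} {U : X.Opens} (t : Γ(L, U)) :
    (1 : Γ(X, U)) ∈ extendable t 0 :=
  ⟨(1 : Γ(X, ⊤)), by rw [one_smul]; exact map_one (resO le_top)⟩

theorem pow_mem_extendable [IsIntegral X] {L : X.Modules} (hL : IsLineBundle L) {U : X.Opens}
    (hU : (U : Set X).Nonempty) (t : Γ(L, U)) {m : ℕ} {a : Γ(X, U)}
    (ha : a ∈ extendable t m) (n : ℕ) : a ^ n ∈ extendable t (m * n) := by
  induction n with
  | zero => simpa using one_mem_extendable_zero t
  | succ n ih => simpa [pow_succ, mul_add] using mul_mem_extendable hL hU t ih ha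

theorem extendable_powSection [IsIntegral X] {L : X.Modules} (hL : IsLineBundle L) {U : X.Opens}
    (hU : (U : Set X).Nonempty) (t : Γ(L, U)) (r m : ℕ) :
    extendable (powSection t r) m = extendable t (r * m) := by
  obtain ⟨W, w, g, hW, hw, hg⟩ := exists_cover hL t
  ext f
  rw [mem_extendable_iff hU t hW hw hg,
    mem_extendable_iff hU (powSection t r) hW (fun y ↦ (hw y).powSection r) (g := fun y ↦ g y ^ r)
      (fun y ↦ by rw [res_powSection, res_powSection, hg, powSection_smul])]
  simp only [pow_mul]

end Powers

/-! ### Frobenius powers of ideals in characteristic `p`. -/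

section Frobenius

variable {R : Type*} [CommRing R]

theorem idealFrobPow_eq_map (p : ℕ) [ExpChar R p] (e : ℕ) (I : Ideal R) :
    idealFrobPow (p ^ e) I = I.map (iterateFrobenius R p e) :=
  rfl

theorem idealFrobPow_add (p : ℕ) [ExpChar R p] (e e' : ℕ) (I : Ideal R) :
    idealFrobPow (p ^ (e + e')) I = idealFrobPow (p ^ e') (idealFrobPow (p ^ e) I) := by
  simp only [idealFrobPow_eq_map, Ideal.map_map]
  congr 1
  ext x
  simp [iterateFrobenius_def, pow_add, pow_mul]

theorem idealFrobPow_antitone (p : ℕ) [ExpChar R p] {e e' : ℕ} (h : e' ≤ e) (I : Ideal R) :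
    idealFrobPow (p ^ e) I ≤ idealFrobPow (p ^ e') I := by
  refine Ideal.span_le.mpr ?_
  rintro _ ⟨f, hf, rfl⟩
  refine Ideal.subset_span ⟨f ^ p ^ (e - e'), Ideal.pow_mem_of_mem _ hf _ ?_, ?_⟩
  · exact pow_pos (expChar_pos R p) _
  · simp only [← pow_mul, ← pow_add, Nat.sub_add_cancel h]

/-- If `A` and `B` surject onto `R / I^[p^e]` and `R / I^[p^e']`, then `A^(p^e') * B` generates a
subgroup surjecting onto `R / I^[p^(e + e')]`. -/
theorem sup_idealFrobPow_eq_top (p : ℕ) [ExpChar R p] {e e' : ℕ} {I : Ideal R} (hI : I.FG)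
    {A B C : AddSubgroup R}
    (hA : A ⊔ (idealFrobPow (p ^ e) I).toAddSubgroup = ⊤)
    (hB : B ⊔ (idealFrobPow (p ^ e') I).toAddSubgroup = ⊤)
    (hC : ∀ a ∈ A, ∀ b ∈ B, a ^ p ^ e' * b ∈ C) :
    C ⊔ (idealFrobPow (p ^ (e + e')) I).toAddSubgroup = ⊤ := by
  set D := C ⊔ (idealFrobPow (p ^ (e + e')) I).toAddSubgroup with hD
  -- Write `j = a + z` with `a ∈ A`, `z ∈ I^[p ^ e]`. Additivity of Frobenius splits `b * j ^ p ^
  -- e'` into an element of `C` and one of `I^[p ^ (e + e')]`.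
  have hbj (b : R) (hb : b ∈ B) (j : R) : b * j ^ p ^ e' ∈ D := by
    obtain ⟨a, ha, z, hz, rfl⟩ := AddSubgroup.mem_sup.mp (hA ▸ AddSubgroup.mem_top j)
    rw [add_pow_expChar_pow, mul_add, mul_comm b]
    refine add_mem (AddSubgroup.mem_sup_left (hC a ha b hb)) (AddSubgroup.mem_sup_right ?_)
    rw [idealFrobPow_add]
    exact Ideal.mul_mem_left _ _ (Ideal.subset_span ⟨z, hz, rfl⟩)
  -- Induction on `n`: for `j ∈ I ^ n` and `r = b + z` with `b ∈ B`, `z ∈ I^[p ^ e']`, the element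
  -- `b * j ^ p ^ e'` lies in `D` and `z * j ^ p ^ e'` in `(I ^ (n + 1))^[p ^ e']`.
  have key (n : ℕ) : D ⊔ (idealFrobPow (p ^ e') (I ^ n)).toAddSubgroup = ⊤ := by
    induction n with
    | zero =>
      rw [pow_zero, Ideal.one_eq_top, idealFrobPow_eq_map, Ideal.map_top]
      exact eq_top_iff.mpr (le_trans (b := (⊤ : Ideal R).toAddSubgroup) (fun _ _ ↦ trivial) le_sup_right)
    | succ n ih =>
      refine top_le_iff.mp (ih.symm.trans_le (sup_le le_sup_left fun x hx ↦ ?_))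
      -- `D` is only an additive subgroup, so the multiplier `r` must be carried through the span
      -- induction.
      suffices ∀ r : R, r * x ∈ D ⊔ (idealFrobPow (p ^ e') (I ^ (n + 1))).toAddSubgroup by
        simpa using this 1
      induction (show x ∈ Submodule.span R _ from hx) using Submodule.span_induction with
      | zero => simp
      | add a b _ _ ha hb =>
        intro r
        rw [mul_add]
        exact add_mem (ha ‹_› r) (hb ‹_› r)
      | smul s a _ ha =>
        intro r
        rw [smul_eq_mul, ← mul_assoc]
        exact ha ‹_› _
      | mem a ha =>
        obtain ⟨j, hj, rfl⟩ := ha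
        intro r
        obtain ⟨b, hb, z, hz, rfl⟩ := AddSubgroup.mem_sup.mp (hB ▸ AddSubgroup.mem_top r)
        rw [add_mul]
        refine add_mem (AddSubgroup.mem_sup_left (hbj b hb j)) (AddSubgroup.mem_sup_right ?_)
        rw [pow_succ', idealFrobPow_eq_map, Ideal.map_mul]
        exact Ideal.mul_mem_mul hz (Ideal.mem_map_of_mem (iterateFrobenius R p e') hj)
  -- As `I` is finitely generated, `I ^ n ≤ I^[p ^ e]` for some `n`; the error term in `key n` is
  -- then contained in `D`.
  obtain ⟨n, hn⟩ := Ideal.exists_pow_le_of_le_radical_of_fg (I := I)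
    (J := idealFrobPow (p ^ e) I) (fun f hf ↦ ⟨p ^ e, Ideal.subset_span ⟨f, hf, rfl⟩⟩) hI
  refine top_le_iff.mp ((key n).symm.trans_le (sup_le le_rfl (le_trans ?_ le_sup_right)))
  rw [idealFrobPow_add, idealFrobPow_eq_map, idealFrobPow_eq_map p e' (idealFrobPow _ _)]
  exact Ideal.map_mono hn

end Frobenius

/-! ### Separation of jets in terms of functions on an affine neighbourhood. -/

section Jets

variable {X : Scheme.{u}}

theorem quotientSheaf_subsingleton (J : X.IdealSheafData) {V : X.Opens} (hV : IsAffineOpen V)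
    (hJ : J.ideal ⟨V, hV⟩ = ⊤) {W : X.Opens} (h : W ≤ V) : Subsingleton Γ(quotientSheaf J, W) := by
  have h1 : (J.subschemeι.app V).hom 1 = 0 := by
    rw [← RingHom.mem_ker, J.ker_subschemeι_app ⟨V, hV⟩, hJ]
    trivial
  have h2 : (1 : Γ(J.subscheme, J.subschemeι ⁻¹ᵁ V)) = 0 := (map_one _).symm.trans h1
  have h3 : (1 : Γ(J.subscheme, J.subschemeι ⁻¹ᵁ W)) = 0 := by
    have := congr(resO (show J.subschemeι ⁻¹ᵁ W ≤ J.subschemeι ⁻¹ᵁ V from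
      J.subschemeι.preimage_mono h) $h2)
    rwa [map_one, map_zero] at this
  exact subsingleton_of_zero_eq_one (M₀ := Γ(J.subscheme, J.subschemeι ⁻¹ᵁ W)) h3.symm

/-- For an ideal sheaf cosupported at a point, surjectivity of the restriction map can be checked
on an affine open neighbourhood over which the line bundle is trivial. -/
theorem restriction_surjective_iff (M : X.Modules) (J : X.IdealSheafData) {x : X}
    (hx : IsClosed {x}) (hJ : ∀ V : X.affineOpens, x ∉ V.1 → J.ideal V = ⊤) {U : X.Opens}
    (hU : IsAffineOpen U) (hxU : x ∈ U) {t : Γ(M, U)} (ht : IsGenerator M t) :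
    Function.Surjective (restriction M J) ↔
      ∀ b : Γ(X, U), ∃ s : Γ(M, ⊤), ∃ f : Γ(X, U), res M le_top s = f • t ∧
        b - f ∈ J.ideal ⟨U, hU⟩ := by
  let Q := quotientSheaf J
  let T := tensor M Q
  let Z : X.Opens := ⟨{x}ᶜ, hx.isOpen_compl⟩
  have hT (W : X.Opens) (hW : x ∉ W) : Subsingleton Γ(T, W) := by
    refine tensor_subsingleton M Q fun y hy ↦ ?_
    obtain ⟨_, ⟨V, hV, rfl⟩, hyV, hVW⟩ :=
      X.isBasis_affineOpens.exists_subset_of_mem_open hy W.2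
    exact ⟨V, hyV, fun W' hW' ↦ quotientSheaf_subsingleton J hV
      (hJ ⟨V, hV⟩ fun h ↦ hW (hVW h)) hW'⟩
  -- `T` vanishes away from `x`, so the sheaf condition for the cover by `U` and the complement of
  -- `x` makes restriction of sections of `T` from `X` to `U` bijective.
  let 𝒲 : ULift.{u} Bool → X.Opens := fun i ↦ if i.down then U else Z
  have hc : (⊤ : X.Opens) ≤ iSup 𝒲 := fun y _ ↦ by
    by_cases hy : y = x
    · exact Opens.mem_iSup.mpr ⟨⟨true⟩, hy ▸ hxU⟩
    · exact Opens.mem_iSup.mpr ⟨⟨false⟩, hy⟩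
  have hZ : x ∉ Z := fun h ↦ h rfl
  have hinj : Function.Injective (res T (le_top : U ≤ ⊤)) := fun a b hab ↦
    section_ext T 𝒲 (fun _ ↦ le_top) hc fun i ↦ match i with
      | ⟨true⟩ => hab
      | ⟨false⟩ => (hT Z hZ).elim _ _
  have hsurj : Function.Surjective (res T (le_top : U ≤ ⊤)) := fun a ↦ by
    obtain ⟨s, hs⟩ := exists_glue T 𝒲 (fun _ ↦ le_top) hc
      (fun i ↦ match i with
        | ⟨true⟩ => a
        | ⟨false⟩ => (0 : Γ(T, Z))) (fun i j ↦ match i, j with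
      | ⟨true⟩, ⟨true⟩ => rfl
      | ⟨false⟩, ⟨true⟩ => (hT (Z ⊓ U) fun h ↦ hZ h.1).elim _ _
      | ⟨true⟩, ⟨false⟩ => (hT (U ⊓ Z) fun h ↦ hZ h.2).elim _ _
      | ⟨false⟩, ⟨false⟩ => rfl)
    exact ⟨s, hs ⟨true⟩⟩
  let one : Γ(Q, U) := (1 : Γ(J.subscheme, J.subschemeι ⁻¹ᵁ U))
  have hone : res Q (le_top : U ≤ ⊤) (quotientOne J) = one := map_one (resO _)
  have hsmul (f : Γ(X, U)) : f • one = (J.subschemeι.app U).hom f :=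
    mul_one ((J.subschemeι.app U).hom f)
  have heq (f b : Γ(X, U)) : f • one = b • one ↔ b - f ∈ J.ideal ⟨U, hU⟩ := by
    rw [hsmul, hsmul, ← J.ker_subschemeι_app ⟨U, hU⟩, RingHom.mem_ker, map_sub, sub_eq_zero,
      eq_comm]
    rfl
  have hres (s : Γ(M, ⊤)) (f : Γ(X, U)) (hs : res M le_top s = f • t) :
      res T le_top (restriction M J s) = tmul t (f • one) := by
    rw [tmul_smul, ← smul_tmul, ← hs, ← hone]
    exact tmul_res M Q le_top s (quotientOne J)
  constructor
  · intro H b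
    obtain ⟨y, hy⟩ := hsurj (tmul t (b • one))
    obtain ⟨s, rfl⟩ := H y
    obtain ⟨f, hf⟩ := (ht le_rfl).2 (res M le_top s)
    simp only [res_refl] at hf
    refine ⟨s, f, hf.symm, (heq f b).mp ?_⟩
    exact tmul_injective M Q ht ((hres s f hf.symm).symm.trans hy)
  · intro H y
    obtain ⟨n, hn⟩ := (tmul_bijective M Q ht).2 (res T le_top y)
    obtain ⟨b, hb⟩ := J.subschemeι_app_surjective ⟨U, hU⟩ n
    obtain ⟨s, f, hs, hf⟩ := H b
    refine ⟨s, hinj ((hres s f hs).trans (Eq.trans ?_ hn))⟩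
    rw [(heq f b).mpr hf, hsmul]
    exact congr(tmul t $hb)

theorem frobPow_idealOfPoint_ideal_eq_top {x : X} (hx : IsClosed {x}) (q n : ℕ)
    (V : X.affineOpens) (hV : x ∉ V.1) : (frobPow q (idealOfPoint x hx ^ n)).ideal V = ⊤ := by
  have h1 : (idealOfPoint x hx).ideal V = ⊤ := by
    unfold idealOfPoint
    rw [Scheme.IdealSheafData.vanishingIdeal_ideal]
    have : V.2.fromSpec ⁻¹' {x} = ∅ := by
      refine Set.preimage_singleton_eq_empty.mpr fun h ↦ hV ?_
      rwa [V.2.range_fromSpec] at h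
    exact (congrArg PrimeSpectrum.vanishingIdeal this).trans PrimeSpectrum.vanishingIdeal_empty
  refine (Ideal.eq_top_iff_one _).mpr (Ideal.subset_span ⟨1, ?_, one_pow q⟩)
  change 1 ∈ ((idealOfPoint x hx).ideal V) ^ n
  rw [h1, Ideal.top_pow]
  trivial

theorem separatesFrobJets_iff {L : X.Modules} (p ℓ e n : ℕ) {x : X} (hx : IsClosed {x})
    {U : X.Opens} (hU : IsAffineOpen U) (hxU : x ∈ U) {t : Γ(L, U)} (ht : IsGenerator L t) :
    SeparatesFrobJets p ℓ e (tensorPow L n) x hx ↔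
      extendable t n ⊔ (idealFrobPow (p ^ e)
        ((idealOfPoint x hx).ideal ⟨U, hU⟩ ^ (ℓ + 1))).toAddSubgroup = ⊤ := by
  refine (restriction_surjective_iff (tensorPow L n) _ hx
    (frobPow_idealOfPoint_ideal_eq_top hx _ _) hU hxU (ht.powSection n)).trans ?_
  rw [eq_top_iff]
  constructor
  · intro H b _
    obtain ⟨s, f, hs, hf⟩ := H b
    exact AddSubgroup.mem_sup.mpr ⟨f, ⟨s, hs⟩, b - f, hf, add_sub_cancel _ _⟩
  · intro H b
    obtain ⟨f, ⟨s, hs⟩, z, hz, rfl⟩ := AddSubgroup.mem_sup.mp (H (AddSubgroup.mem_top b))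
    exact ⟨s, f, hs, by simpa using! hz⟩

end Jets

/-! ### The supremum attached to an abstract relation `S`. -/

section Arithmetic

open Classical in
/-- The supremum of the natural numbers with property `P`, with value `⊥` if there are none. -/
def supOf (P : ℕ → Prop) : WithBot ℕ∞ :=
  if ∃ e : ℕ, P e then ((⨆ e : {e : ℕ // P e}, ((e : ℕ) : ℕ∞) : ℕ∞) : WithBot ℕ∞) else ⊥

theorem le_extPow_supOf {p : ℕ} (hp : 1 < p) {P : ℕ → Prop} {e : ℕ} (he : P e) :
    ((p ^ e : ℕ) : EReal) ≤ extPow p (supOf P) := by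
  rw [supOf, if_pos ⟨e, he⟩]
  have h : (e : ℕ∞) ≤ ⨆ e : {e : ℕ // P e}, ((e : ℕ) : ℕ∞) :=
    le_iSup (fun e : {e : ℕ // P e} ↦ ((e : ℕ) : ℕ∞)) ⟨e, he⟩
  generalize (⨆ e : {e : ℕ // P e}, ((e : ℕ) : ℕ∞)) = s at h
  cases s with
  | top => exact le_top
  | coe n => exact Nat.cast_le.mpr (Nat.pow_le_pow_right hp.le (Nat.cast_le.mp h))

theorem extPow_supOf_le {p : ℕ} (hp : 1 < p) {P : ℕ → Prop} {d : EReal} (hd : 0 ≤ d)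
    (h : ∀ e, P e → ((p ^ e : ℕ) : EReal) ≤ d) : extPow p (supOf P) ≤ d := by
  by_cases hP : ∃ e, P e
  swap
  · rw [supOf, if_neg hP]
    exact hd
  rw [supOf, if_pos hP]
  generalize hs : (⨆ e : {e : ℕ // P e}, ((e : ℕ) : ℕ∞)) = s
  cases s with
  | top =>
    suffices d = ⊤ from this ▸ le_top
    refine EReal.eq_top_iff_forall_lt d |>.mpr fun y ↦ ?_
    obtain ⟨n, hn⟩ := exists_nat_gt y
    obtain ⟨⟨e, he⟩, hne⟩ := lt_iSup_iff.mp (hs ▸ ENat.natCast_lt_top n)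
    refine lt_of_lt_of_le ?_ (h e he)
    have h1 : n < p ^ e := (Nat.cast_lt.mp hne).trans (Nat.lt_pow_self hp)
    exact EReal.coe_lt_coe_iff.mpr (hn.trans (Nat.cast_lt.mpr h1))
  | coe n =>
    obtain ⟨⟨e, he⟩, hne⟩ : ∃ e : {e : ℕ // P e}, (n : ℕ∞) ≤ ((e : ℕ) : ℕ∞) := by
      by_contra! H
      rcases n with _ | n
      · obtain ⟨e, he⟩ := hP
        exact absurd (H ⟨e, he⟩) (by simp)
      · have : (⨆ e : {e : ℕ // P e}, ((e : ℕ) : ℕ∞)) ≤ n :=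
          iSup_le fun e ↦ Nat.cast_le.mpr (Nat.lt_succ_iff.mp (Nat.cast_lt.mp (H e)))
        rw [hs] at this
        exact absurd (Nat.cast_le.mp this) (by simp)
    exact le_trans (Nat.cast_le.mpr (Nat.pow_le_pow_right hp.le (Nat.cast_le.mp hne))) (h e he)

/-- The supremum defining the Frobenius–Seshadri constant, for an arbitrary relation in place of
separation of jets. -/
def seshadriSup (p ℓ : ℕ) (S : ℕ → ℕ → Prop) : EReal :=
  ⨆ (m : ℕ) (_ : 1 ≤ m),
    (extPow p (supOf (S m)) - 1) / (((m : ℝ) / ((ℓ : ℝ) + 1) : ℝ) : EReal)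

variable {p : ℕ} (ℓ : ℕ) {S : ℕ → ℕ → Prop}

/-- Even when no `e` exists, the term at `m` is at least `-(ℓ + 1) / m`, which tends to `0`. Hence
exponents without any `e`, whose terms are negative, do not affect the comparison of suprema. -/
theorem seshadriSup_nonneg (hp : 1 < p) : 0 ≤ seshadriSup p ℓ S := by
  have h (m : ℕ) : ((-((ℓ : ℝ) + 1) / ((m + 1 : ℕ) : ℝ) : ℝ) : EReal) ≤ seshadriSup p ℓ S := by
    refine le_trans ?_ (le_iSup₂_of_le (m + 1) (Nat.le_add_left 1 m) le_rfl)
    have h1 : (0 : EReal) ≤ extPow p (supOf (S (m + 1))) := by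
      by_cases hP : ∃ e, S (m + 1) e
      · obtain ⟨e, he⟩ := hP
        exact le_trans (show (0 : EReal) ≤ ((p ^ e : ℕ) : EReal) from
          EReal.coe_nonneg.mpr (Nat.cast_nonneg _)) (le_extPow_supOf hp he)
      · rw [supOf, if_neg hP]
        exact le_rfl
    have h2 : (0 : EReal) ≤ ((((m + 1 : ℕ) : ℝ) / ((ℓ : ℝ) + 1) : ℝ) : EReal) :=
      EReal.coe_nonneg.mpr (by positivity)
    refine le_trans (le_of_eq ?_) (EReal.div_le_div_right_of_nonneg h2 (EReal.sub_le_sub h1 le_rfl))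
    rw [zero_sub, ← EReal.coe_one, ← EReal.coe_neg, ← EReal.coe_div]
    congr 1
    field_simp
  refine le_of_tendsto' (x := Filter.atTop) ?_ h
  rw [← EReal.coe_zero]
  refine (continuous_coe_real_ereal.tendsto 0).comp ?_
  exact (tendsto_const_div_atTop_nhds_zero_nat (-((ℓ : ℝ) + 1))).comp (Filter.tendsto_add_atTop_nat 1)

theorem le_seshadriSup (hp : 1 < p) {m e : ℕ} (hm : 1 ≤ m) (h : S m e) :
    ((((p ^ e : ℕ) : ℝ) - 1) / ((m : ℝ) / ((ℓ : ℝ) + 1)) : ℝ) ≤ seshadriSup p ℓ S := by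
  refine le_trans ?_ (le_iSup₂_of_le m hm le_rfl)
  have h2 : (0 : EReal) ≤ (((m : ℝ) / ((ℓ : ℝ) + 1) : ℝ) : EReal) :=
    EReal.coe_nonneg.mpr (by positivity)
  rw [EReal.coe_div, EReal.coe_sub]
  exact EReal.div_le_div_right_of_nonneg h2 (EReal.sub_le_sub (le_extPow_supOf hp h) le_rfl)

theorem seshadriSup_le (hp : 1 < p) {c : EReal} (hc : 0 ≤ c)
    (h : ∀ m e, 1 ≤ m → S m e →
      ((((p ^ e : ℕ) : ℝ) - 1) / ((m : ℝ) / ((ℓ : ℝ) + 1)) : ℝ) ≤ c) :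
    seshadriSup p ℓ S ≤ c := by
  refine iSup₂_le fun m hm ↦ ?_
  have hpos : (0 : ℝ) < (m : ℝ) / ((ℓ : ℝ) + 1) := by
    have : (0 : ℝ) < m := Nat.cast_pos.mpr hm
    positivity
  have h2 : (0 : EReal) < (((m : ℝ) / ((ℓ : ℝ) + 1) : ℝ) : EReal) := EReal.coe_pos.mpr hpos
  have hbot : (1 : EReal) ≠ ⊥ := EReal.coe_ne_bot 1
  have htop : (1 : EReal) ≠ ⊤ := EReal.coe_ne_top 1
  rw [EReal.div_le_iff_le_mul h2 (EReal.coe_ne_top _), EReal.sub_le_iff_le_add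
    (.inl hbot) (.inl htop)]
  refine extPow_supOf_le hp (add_nonneg (mul_nonneg h2.le hc) zero_le_one) fun e he ↦ ?_
  rw [← EReal.sub_le_iff_le_add (.inl hbot) (.inl htop), ← EReal.div_le_iff_le_mul h2
    (EReal.coe_ne_top _)]
  refine le_trans (le_of_eq ?_) (h m e hm he)
  rw [EReal.coe_div _ ((m : ℝ) / _), EReal.coe_sub]
  rfl

theorem rel_geomSum (hmono : ∀ m e e', e' ≤ e → S m e → S m e')
    (hmul : ∀ m n e e', S m e → S n e' → S (m * p ^ e' + n) (e + e')) {m e : ℕ} (h : S m e)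
    {j : ℕ} (hj : 1 ≤ j) (n : ℕ) :
    S (m * (∑ i ∈ Finset.range n, (p ^ e) ^ i + j)) (n * e) := by
  induction n with
  | zero =>
    have h0 : S m 0 := hmono m e 0 (Nat.zero_le e) h
    simp only [Finset.range_zero, Finset.sum_empty, zero_add, zero_mul]
    induction j, hj using Nat.le_induction with
    | base => simpa using h0
    | succ j _ ih => simpa [mul_add, add_comm] using hmul m _ 0 0 h0 ih
  | succ n ih =>
    -- Taking `e' = n * e` contributes the new top term `m * q ^ n` of the geometric sum.
    convert hmul m _ e _ h ih using 1
    · rw [Finset.sum_range_succ, ← pow_mul, mul_comm e n]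
      ring
    · ring

theorem seshadriSup_mul (hp : 1 < p) (hmono : ∀ m e e', e' ≤ e → S m e → S m e')
    (hmul : ∀ m n e e', S m e → S n e' → S (m * p ^ e' + n) (e + e')) {r : ℕ} (hr : 0 < r) :
    seshadriSup p ℓ (fun m ↦ S (r * m)) = r * seshadriSup p ℓ S := by
  have hr' : (0 : ℝ) < r := Nat.cast_pos.mpr hr
  have hrE : (0 : EReal) < ((r : ℝ) : EReal) := EReal.coe_pos.mpr hr'
  change _ = ((r : ℝ) : EReal) * _
  apply le_antisymm
  -- The term at `m` on the left is `r` times the term at `r * m` of the full supremum.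
  · refine seshadriSup_le ℓ hp (mul_nonneg hrE.le (seshadriSup_nonneg ℓ hp)) fun m e hm h ↦ ?_
    have hm' : (0 : ℝ) < m := Nat.cast_pos.mpr hm
    refine le_trans (le_of_eq ?_) (mul_le_mul_of_nonneg_left
      (le_seshadriSup ℓ hp (Nat.mul_pos hr hm) h) hrE.le)
    rw [← EReal.coe_mul]
    congr 1
    push_cast
    field_simp
  · rw [mul_comm, ← EReal.le_div_iff_mul_le hrE (EReal.coe_ne_top _)]
    refine seshadriSup_le ℓ hp (EReal.div_nonneg (seshadriSup_nonneg ℓ hp) hrE.le)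
      fun m e hm h ↦ ?_
    have hm' : (0 : ℝ) < m := Nat.cast_pos.mpr hm
    rw [EReal.le_div_iff_mul_le hrE (EReal.coe_ne_top _), mul_comm, ← EReal.coe_mul]
    rcases Nat.eq_zero_or_pos e with rfl | he
    · simpa using seshadriSup_nonneg ℓ hp
    set q := p ^ e with hq
    have hq1 : 1 < q := Nat.one_lt_pow he.ne' hp
    set σ : ℕ → ℕ := fun n ↦ ∑ i ∈ Finset.range n, q ^ i with hσ
    have hσn (n : ℕ) : n ≤ σ n := by
      simpa using Finset.card_nsmul_le_sum (Finset.range n) (fun i ↦ q ^ i) 1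
        fun i _ ↦ Nat.one_le_pow _ _ (by omega)
    have hσq (n : ℕ) : ((q ^ n : ℕ) : ℝ) - 1 = ((q : ℝ) - 1) * σ n := by
      simp only [hσ]
      push_cast
      rw [mul_comm, geom_sum_mul]
    -- With `j = r - σ n % r`, which lies between `1` and `r`, and `σ n + j = r * c`, this is a
    -- lower bound for the term at `m * c`. It uses `r * c ≤ σ n + r`, and its last factor tends to
    -- `1`.
    have hbound (n : ℕ) : ((((r : ℝ) * (((q : ℝ) - 1) / ((m : ℝ) / ((ℓ : ℝ) + 1)))) *
        (1 - r / (σ n + r)) : ℝ) : EReal) ≤ seshadriSup p ℓ (fun m ↦ S (r * m)) := by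
      have hmod : σ n % r < r := Nat.mod_lt _ hr
      have hdvd : r ∣ σ n + (r - σ n % r) := by
        refine ⟨σ n / r + 1, ?_⟩
        have := Nat.div_add_mod (σ n) r
        rw [mul_add, mul_one]
        omega
      set j := r - σ n % r with hj
      obtain ⟨c, hc⟩ := hdvd
      have hS := rel_geomSum hmono hmul h (j := j) (by omega) n
      rw [hc, Nat.mul_left_comm] at hS
      have hc0 : 0 < c := Nat.pos_of_ne_zero fun h0 ↦ by
        rw [h0] at hc
        omega
      refine le_trans (EReal.coe_le_coe_iff.mpr ?_) (le_seshadriSup ℓ hp (Nat.mul_pos hm hc0) hS)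
      have hc' : (0 : ℝ) < c := Nat.cast_pos.mpr hc0
      have hcr : (r : ℝ) * c ≤ σ n + r := by
        have : r * c ≤ σ n + r := by omega
        exact_mod_cast this
      rw [Nat.mul_comm n e, pow_mul, ← hq, hσq]
      have hq0 : (0 : ℝ) ≤ (q : ℝ) - 1 := by
        have : (1 : ℝ) < q := by exact_mod_cast hq1
        linarith
      have hs0 : (0 : ℝ) ≤ σ n := Nat.cast_nonneg _
      have e1 : ((r : ℝ) * (((q : ℝ) - 1) / ((m : ℝ) / ((ℓ : ℝ) + 1)))) * (1 - r / (σ n + r)) =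
          (((q : ℝ) - 1) * σ n * (ℓ + 1) / m) * (r / (σ n + r)) := by
        field_simp
        ring
      have e2 : ((q : ℝ) - 1) * σ n / (((m * c : ℕ) : ℝ) / ((ℓ : ℝ) + 1)) =
          (((q : ℝ) - 1) * σ n * (ℓ + 1) / m) * (1 / c) := by
        push_cast
        field_simp
      rw [e1, e2]
      refine mul_le_mul_of_nonneg_left ?_ (by positivity)
      rw [div_le_div_iff₀ (by positivity) hc', one_mul]
      exact hcr
    refine le_of_tendsto' (x := Filter.atTop) ?_ hbound
    refine (continuous_coe_real_ereal.tendsto _).comp ?_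
    have h1 : Filter.Tendsto (fun n ↦ (r : ℝ) / (σ n + r)) Filter.atTop (nhds 0) := by
      refine Filter.Tendsto.div_atTop tendsto_const_nhds ?_
      refine Filter.tendsto_atTop_mono (fun n ↦ ?_) tendsto_natCast_atTop_atTop
      have : (n : ℝ) ≤ σ n := by exact_mod_cast hσn n
      linarith
    simpa using ((tendsto_const_nhds (x := (1 : ℝ))).sub h1).const_mul
      ((r : ℝ) * (((q : ℝ) - 1) / ((m : ℝ) / ((ℓ : ℝ) + 1))))

end Arithmetic

/-! ### Application to projective varieties. -/

section Main

attribute [local instance] MvPolynomial.gradedAlgebra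

theorem frobSeshadri_eq_seshadriSup {X : Scheme.{u}} (p ℓ : ℕ) (L : X.Modules) (x : X)
    (hx : IsClosed {x}) :
    frobSeshadri p ℓ L x hx =
      seshadriSup p ℓ fun m e ↦ SeparatesFrobJets p ℓ e (tensorPow L m) x hx :=
  rfl

theorem locallyOfFiniteType_projectiveSpaceToSpec (k : Type u) [Field k] (n : ℕ) :
    LocallyOfFiniteType (projectiveSpaceToSpec k n) := by
  let 𝒜 := MvPolynomial.homogeneousSubmodule (Fin (n + 1)) k
  have hft : Algebra.FiniteType (𝒜 0) (MvPolynomial (Fin (n + 1)) k) := by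
    have : IsScalarTower k (𝒜 0) (MvPolynomial (Fin (n + 1)) k) :=
      .of_algebraMap_eq (R := k) (S := 𝒜 0) fun _ ↦ rfl
    exact Algebra.FiniteType.of_restrictScalars_finiteType k _ _
  have h1 : LocallyOfFiniteType (Proj.toSpecZero 𝒜) := inferInstance
  have hsurj : Function.Surjective (algebraMap k (𝒜 0)) := by
    rintro ⟨f, hf⟩
    refine ⟨f.coeff 0, Subtype.ext ?_⟩
    exact (MvPolynomial.totalDegree_eq_zero_iff_eq_C.mp
      ((MvPolynomial.totalDegree_zero_iff_isHomogeneous _).mpr hf)).symm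
  have h2 : LocallyOfFiniteType (Spec.map (CommRingCat.ofHom (algebraMap k (𝒜 0)))) := by
    rw [HasRingHomProperty.Spec_iff (P := @LocallyOfFiniteType)]
    exact RingHom.FiniteType.of_surjective _ hsurj
  exact inferInstanceAs (LocallyOfFiniteType (Proj.toSpecZero 𝒜 ≫ Spec.map _))

/-- This provides the finite generation of `I` needed in `sup_idealFrobPow_eq_top`. -/
theorem IsProjectiveVariety.isLocallyNoetherian {k : Type u} [Field k] {X : Scheme.{u}}
    {π : X ⟶ Spec (.of k)} (hX : IsProjectiveVariety π) : IsLocallyNoetherian X := by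
  obtain ⟨n, i, hi, rfl⟩ := hX.exists_closedImmersion
  have := locallyOfFiniteType_projectiveSpaceToSpec k n
  exact LocallyOfFiniteType.isLocallyNoetherian (i ≫ projectiveSpaceToSpec k n)

theorem charP_section {k : Type u} [Field k] (p : ℕ) [CharP k p] {X : Scheme.{u}}
    (π : X ⟶ Spec (.of k)) (U : X.Opens) [Nontrivial Γ(X, U)] : CharP Γ(X, U) p := by
  let φ : k →+* Γ(X, U) := (resO le_top).comp
    (((Scheme.ΓSpecIso (.of k)).inv ≫ π.appTop).hom)
  exact (RingHom.charP_iff φ φ.injective p).mp inferInstance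

theorem exists_affine_isGenerator {X : Scheme.{u}} {L : X.Modules} (hL : IsLineBundle L) (x : X) :
    ∃ (U : X.Opens) (t : Γ(L, U)), IsAffineOpen U ∧ x ∈ U ∧ IsGenerator L t := by
  obtain ⟨V, t, hx, ht⟩ := hL.exists_isGenerator x
  obtain ⟨_, ⟨U, hU, rfl⟩, hxU, hUV⟩ :=
    X.isBasis_affineOpens.exists_subset_of_mem_open hx V.2
  exact ⟨U, res L hUV t, hU, hxU, ht.res hUV⟩

theorem frobSeshadri_tensorPow {k : Type u} [Field k] (p : ℕ) [Fact p.Prime] [CharP k p]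
    {X : Scheme.{u}} (π : X ⟶ Spec (.of k)) [IsIntegral X] [IsLocallyNoetherian X]
    {L : X.Modules} (hL : IsLineBundle L) (x : X) (hx : IsClosed {x}) (ℓ : ℕ) {r : ℕ}
    (hr : 0 < r) :
    frobSeshadri p ℓ (tensorPow L r) x hx = (r : EReal) * frobSeshadri p ℓ L x hx := by
  obtain ⟨U, t, hU, hxU, ht⟩ := exists_affine_isGenerator hL x
  have hne : (U : Set X).Nonempty := ⟨x, hxU⟩
  have : Nonempty U := ⟨⟨x, hxU⟩⟩
  have : CharP Γ(X, U) p := charP_section p π U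
  have : ExpChar Γ(X, U) p := .prime Fact.out
  have : IsNoetherianRing Γ(X, U) := IsLocallyNoetherian.component_noetherian ⟨U, hU⟩
  set I := (idealOfPoint x hx).ideal ⟨U, hU⟩ ^ (ℓ + 1)
  rw [frobSeshadri_eq_seshadriSup, frobSeshadri_eq_seshadriSup]
  -- Using `t ^ r` as generator of `L ^ r` turns both constants into suprema for one relation on
  -- subgroups of `Γ(X, U)`, evaluated at `r * m` and at `m`.
  simp only [separatesFrobJets_iff p ℓ _ _ hx hU hxU ht,
    separatesFrobJets_iff p ℓ _ _ hx hU hxU (ht.powSection r), extendable_powSection hL hne]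
  refine seshadriSup_mul ℓ (S := fun m e ↦ extendable t m ⊔
    (idealFrobPow (p ^ e) I).toAddSubgroup = ⊤) (Nat.Prime.one_lt Fact.out) ?_ ?_ hr
  · intro m e e' he h
    exact top_le_iff.mp (h.symm.trans_le (sup_le_sup_left
      (fun _ h ↦ idealFrobPow_antitone p he I h) _))
  · intro m n e e' h h'
    exact sup_idealFrobPow_eq_top p (IsNoetherian.noetherian I) h h' fun a ha b hb ↦
      mul_mem_extendable hL hne t (pow_mem_extendable hL hne t ha _) hb

end Main

end FrobSeshadri

end

theorem mainTheorem10 {k : Type u} [Field k] [IsAlgClosed k] (p : ℕ) [Fact p.Prime] [CharP k p]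
    {X : Scheme.{u}} (π : X ⟶ Spec (.of k)) (hX : FrobSeshadri.IsProjectiveVariety π)
    (hdim : 0 < topologicalKrullDim X)
    (L : X.Modules) (hL : FrobSeshadri.IsAmple L)
    (x : X) (hx : IsClosed {x}) (ℓ r : ℕ) (hr : 0 < r) :
    FrobSeshadri.frobSeshadri p ℓ (FrobSeshadri.tensorPow L r) x hx =
      (r : EReal) * FrobSeshadri.frobSeshadri p ℓ L x hx := by
  have := hX.isIntegral
  have := hX.isLocallyNoetherian
  exact FrobSeshadri.frobSeshadri_tensorPow p π hL.2.1 x hx ℓ hr
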